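/- Let $C\subseteq\omega$ be a cohesive set: $C$ is infinite and for every c.e. set $W$, either $C\subseteq^* W$ or $C\subseteq^*\omega\setminus W$, where $C\subseteq^* X$ means that $C\setminus X$ is finite. "For almost every $i$" means: for all $i$ in a set $X$ with $C\subseteq^*X$. For a uniformly computable sequence of structures $(\mathcal A_i)_{i\in\omega}$ with domains contained in $\omega$, the cohesive product $\prod_C\mathcal A_i$ consists of the classes $[\varphi]$ of partial computable functions $\varphi$ such that $\varphi(i)$ is defined and lies in $\mathcal A_i$ for almost every $i$, two functions being identified if they are defined and equal at almost every $i$; the operations are computed entrywise. Elements of $\prod_C\mathbb N$ are called hyper-naturals, and $N<M$ means $N(i)<M(i)$ for almost every $i$. For $N\in\prod_C\mathbb N$ put $\prod_{C,N}\mathcal A_i:=\prod_C\mathcal A_{N(i)}$. For a constant sequence $F$ write $\prod_C F$. Let $K/F$ be a fully computable infinite Galois extension. That is, $F$, $K$ and the embedding $F\to K$ are computable; there are finite Galois subextensions $K_0\subsetneq K_1\subsetneq\cdots$ of $K/F$ with $\bigcup_i K_i=K$; and the fields $K_i$, the embeddings $K_i\to K$ and $K_i\to K_{i+1}$, the groups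 $G_i=\mathrm{Gal}(K_i/F)$, the restriction maps $f_{m,n}:G_m\to G_n$ ($n<m$) and the actions of $G_i$ on $K_i$ are uniformly computable. For hyper-naturals $N<M$ let $f_{M,N}:\prod_{C,M}G_i\to\prod_{C,N}G_i$ be given by $f_{M,N}(g)(i)=f_{M(i),N(i)}(g(i))$, and regard $\prod_{C,N}K_i$ as a subfield of $\prod_{C,M}K_i$ through the entrywise inclusions. Let $\mathrm{Alg}(\prod_{C,N}K_i)$ be the field of elements of $\prod_{C,N}K_i$ that are algebraic over $\prod_CF$, and let $\eta_N$ be the homomorphism from $\prod_{C,N}G_i$ to the group of automorphisms of $\mathrm{Alg}(\prod_{C,N}K_i)$ over $\prod_CF$ that restricts the entrywise action of $\prod_{C,N}G_i$ on $\prod_{C,N}K_i$ to the algebraic part. Then for every hyper-natural $N$ the extension $\mathrm{Alg}(\prod_{C,N}K_i)/\prod_CF$ is Galois, and for the induced homomorphism $$\Theta:\varprojlim_{N\in\prod_C\mathbb N}\ \prod_{C,N}G_i\ \longrightarrow\ \varprojlim_{N\in\prod_C\mathbb N}\mathrm{Gal}\Big(\mathrm{Alg}\big(\prod_{C,N}K_i\big)\Big/\prod_CF\Big),\qquad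 (g_N)_N\mapsto(\eta_N(g_N))_N,$$ where the transition maps are the $f_{M,N}$ on the left and the restriction maps on the right, the following hold. (1) The image of $\Theta$ is dense, where the right-hand side has the topology induced from the product of the Krull topologies. (2) The kernel of $\Theta$ is $\varprojlim_{N\in\prod_C\mathbb N}\ker(\eta_N)$, with transition maps induced by the $f_{M,N}$, as a subgroup of $\varprojlim_{N}\prod_{C,N}G_i$. -/

import Mathlib

open Filter Topology

noncomputable section

namespace Cohesive

/-! ### Cohesive sets and the cohesive power of `ω` -/

/-- A cohesive set: an infinite `C ⊆ ω` such that for every c.e. set `W`, either `C ⊆* W` or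
`C ⊆* ω ∖ W`, where `C ⊆* X` means that `C ∖ X` is finite. -/
structure CohesiveSet where
  carrier : Set ℕ
  infinite : carrier.Infinite
  cohesive : ∀ W : Set ℕ, REPred (fun n => n ∈ W) →
    (carrier \ W).Finite ∨ (carrier \ Wᶜ).Finite

/-- The filter of the sets `X` with `C ⊆* X`. Thus `∀ᶠ i in C.ae, P i` reads
"`P i` holds for almost every `i`", that is, `C ⊆* {i | P i}`. -/
def CohesiveSet.ae (C : CohesiveSet) : Filter ℕ := cofinite ⊓ 𝓟 C.carrier

theorem CohesiveSet.eventually_iff (C : CohesiveSet) (P : ℕ → Prop) :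
    (∀ᶠ i in C.ae, P i) ↔ (C.carrier \ {i | P i}).Finite := by
  rw [CohesiveSet.ae, eventually_inf_principal, eventually_cofinite]
  have : {x | ¬(x ∈ C.carrier → P x)} = C.carrier \ {i | P i} := by
    ext x; simp
  rw [this]

instance CohesiveSet.neBot (C : CohesiveSet) : C.ae.NeBot := by
  rw [neBot_iff]
  intro h
  have h1 : ∀ᶠ i in C.ae, False := by rw [h]; trivial
  rw [C.eventually_iff] at h1
  exact C.infinite (by simpa using h1)

/-- Partial computable functions `φ` with `C ⊆* dom φ`. -/
def PartialRep (C : CohesiveSet) : Type :=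
  {φ : ℕ →. ℕ // Nat.Partrec φ ∧ ∀ᶠ i in C.ae, (φ i).Dom}

/-- `φ ≃_C ψ`: for almost every `i`, `φ i` and `ψ i` are defined and equal. -/
instance PartialRep.setoid (C : CohesiveSet) : Setoid (PartialRep C) where
  r φ ψ := ∀ᶠ i in C.ae, ∃ y, y ∈ φ.1 i ∧ y ∈ ψ.1 i
  iseqv :=
    { refl := fun φ => φ.2.2.mono fun _ h => ⟨_, Part.get_mem h, Part.get_mem h⟩
      symm := fun h => h.mono fun _ ⟨y, h1, h2⟩ => ⟨y, h2, h1⟩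
      trans := by
        intro φ ψ χ h1 h2
        filter_upwards [h1, h2]
        rintro i ⟨y, hy1, hy2⟩ ⟨z, hz1, hz2⟩
        exact ⟨y, hy1, by rwa [Part.mem_unique hy2 hz1]⟩ }

/-- The cohesive power `∏_C ω`: classes `[φ]` of partial computable functions `φ` with
`C ⊆* dom φ` modulo `≃_C`. Its elements are the hyper-natural numbers. -/
def HyperNat (C : CohesiveSet) : Type := Quotient (PartialRep.setoid C)

namespace HyperNat

variable {C : CohesiveSet}

/-- The values of a class `[φ]`: for almost every `i`, this is `φ i` (see `val_mk`). -/
def val (a : HyperNat C) (i : ℕ) : ℕ :=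
  open scoped Classical in if h : (a.out.1 i).Dom then (a.out.1 i).get h else 0

theorem val_mem (a : HyperNat C) : ∀ᶠ i in C.ae, a.val i ∈ a.out.1 i := by
  filter_upwards [a.out.2.2] with i hi
  rw [val, dif_pos hi]
  exact Part.get_mem hi

theorem val_mk (φ : PartialRep C) :
    ∀ᶠ i in C.ae, val (Quotient.mk _ φ : HyperNat C) i ∈ φ.1 i := by
  have h : ∀ᶠ i in C.ae, ∃ y, y ∈ (Quotient.mk _ φ : HyperNat C).out.1 i ∧ y ∈ φ.1 i :=
    Quotient.mk_out (s := PartialRep.setoid C) φ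
  filter_upwards [h, val_mem (Quotient.mk _ φ : HyperNat C)]
  rintro i ⟨y, h1, h2⟩ h3
  rwa [Part.mem_unique h3 h1]

theorem ext_val {a b : HyperNat C} (h : ∀ᶠ i in C.ae, a.val i = b.val i) : a = b := by
  rw [← Quotient.out_eq (s := PartialRep.setoid C) a, ← Quotient.out_eq (s := PartialRep.setoid C) b]
  apply Quotient.sound (s := PartialRep.setoid C)
  change ∀ᶠ i in C.ae, _
  filter_upwards [h, a.val_mem, b.val_mem] with i h1 h2 h3
  exact ⟨_, h2, h1 ▸ h3⟩

/-- The class of the identity function. -/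
def id (C : CohesiveSet) : HyperNat C :=
  Quotient.mk (PartialRep.setoid C)
    ⟨fun i => Part.some i, Nat.Partrec.of_primrec Nat.Primrec.id, Eventually.of_forall fun _ => trivial⟩

/-- `N < M` in `∏_C ℕ`: for almost every `i`, `N(i) < M(i)`. -/
instance : LT (HyperNat C) := ⟨fun N M => ∀ᶠ i in C.ae, N.val i < M.val i⟩

theorem lt_def {N M : HyperNat C} : N < M ↔ ∀ᶠ i in C.ae, N.val i < M.val i := Iff.rfl

end HyperNat

/-! ### Functions that agree almost everywhere with a partial computable function -/

/-- `u` agrees almost everywhere on `C` with a partial computable function. -/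
def AEComp (C : CohesiveSet) (u : ℕ → ℕ) : Prop :=
  ∃ ψ : ℕ →. ℕ, Nat.Partrec ψ ∧ ∀ᶠ i in C.ae, u i ∈ ψ i

/-- The class of a function that agrees almost everywhere with a partial computable one. -/
def AEComp.toHyperNat {C : CohesiveSet} {u : ℕ → ℕ} (h : AEComp C u) : HyperNat C :=
  Quotient.mk (PartialRep.setoid C)
    ⟨h.choose, h.choose_spec.1, h.choose_spec.2.mono fun _ hi => Part.dom_iff_mem.2 ⟨_, hi⟩⟩

theorem AEComp.val_toHyperNat {C : CohesiveSet} {u : ℕ → ℕ} (h : AEComp C u) :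
    ∀ᶠ i in C.ae, h.toHyperNat.val i = u i := by
  filter_upwards [HyperNat.val_mk (C := C) ⟨h.choose, h.choose_spec.1,
    h.choose_spec.2.mono fun _ hi => Part.dom_iff_mem.2 ⟨_, hi⟩⟩, h.choose_spec.2] with i h1 h2
  exact Part.mem_unique h1 h2

theorem HyperNat.aeComp {C : CohesiveSet} (a : HyperNat C) : AEComp C a.val :=
  ⟨a.out.1, a.out.2.1, a.val_mem⟩

theorem AEComp.congr {C : CohesiveSet} {u v : ℕ → ℕ} (hu : AEComp C u)
    (h : ∀ᶠ i in C.ae, v i = u i) : AEComp C v := by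
  obtain ⟨ψ, h1, h2⟩ := hu
  exact ⟨ψ, h1, by filter_upwards [h, h2] with i h3 h4; rwa [h3]⟩

/-- Apply a partial computable function of three variables. -/
theorem AEComp.bind₃ {C : CohesiveSet} {u v w r : ℕ → ℕ} (hu : AEComp C u) (hv : AEComp C v)
    (hw : AEComp C w) {f : ℕ × ℕ × ℕ →. ℕ} (hf : Partrec f)
    (h : ∀ᶠ i in C.ae, r i ∈ f (u i, v i, w i)) : AEComp C r := by
  obtain ⟨φ, h1, h1'⟩ := hu
  obtain ⟨ψ, h2, h2'⟩ := hv
  obtain ⟨χ, h3, h3'⟩ := hw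
  have k1 : Partrec φ := Partrec.nat_iff.2 h1
  have k2 : Partrec ψ := Partrec.nat_iff.2 h2
  have k3 : Partrec χ := Partrec.nat_iff.2 h3
  refine ⟨fun i => (φ i).bind fun a => (ψ i).bind fun b => (χ i).bind fun c => f (a, b, c), ?_, ?_⟩
  · refine Partrec.nat_iff.1 (k1.bind (Partrec.bind (k2.comp Computable.fst) (Partrec.bind
      (k3.comp (Computable.fst.comp Computable.fst)) (hf.comp ?_))))
    exact ((Computable.snd.comp (Computable.fst.comp Computable.fst)).pair
      ((Computable.snd.comp Computable.fst).pair Computable.snd))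
  · filter_upwards [h1', h2', h3', h] with i a b c d
    exact Part.mem_bind a (Part.mem_bind b (Part.mem_bind c d))

theorem AEComp.map₃ {C : CohesiveSet} {u v w r : ℕ → ℕ} (hu : AEComp C u) (hv : AEComp C v)
    (hw : AEComp C w) {f : ℕ × ℕ × ℕ → ℕ} (hf : Computable f)
    (h : ∀ᶠ i in C.ae, r i = f (u i, v i, w i)) : AEComp C r :=
  hu.bind₃ hv hw (f := fun p => Part.some (f p)) hf.partrec (by simpa using h)

theorem AEComp.map₂ {C : CohesiveSet} {u v r : ℕ → ℕ} (hu : AEComp C u) (hv : AEComp C v)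
    {f : ℕ × ℕ → ℕ} (hf : Computable f)
    (h : ∀ᶠ i in C.ae, r i = f (u i, v i)) : AEComp C r :=
  hu.map₃ hv hv (f := fun p => f (p.1, p.2.1))
    (hf.comp (Computable.fst.pair (Computable.fst.comp Computable.snd))) h

theorem AEComp.map₁ {C : CohesiveSet} {u r : ℕ → ℕ} (hu : AEComp C u)
    {f : ℕ → ℕ} (hf : Computable f)
    (h : ∀ᶠ i in C.ae, r i = f (u i)) : AEComp C r :=
  hu.map₂ hu (f := fun p => f p.1) (hf.comp Computable.fst) h

/-- Dichotomy for two elements of `∏_C ω`. -/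
theorem HyperNat.eq_or_ne {C : CohesiveSet} (a b : HyperNat C) :
    a = b ∨ ∀ᶠ i in C.ae, a.val i ≠ b.val i := by
  have ka : Partrec a.out.1 := Partrec.nat_iff.2 a.out.2.1
  have kb : Partrec b.out.1 := Partrec.nat_iff.2 b.out.2.1
  let g : ℕ × ℕ →. Unit := fun p => bif decide (p.1 = p.2) then Part.some () else Part.none
  have hg : Partrec g := Partrec.cond
    ((Primrec.eq.comp Primrec.fst Primrec.snd).decide.to_comp) (Computable.const ()).partrec Partrec.none
  let f : ℕ →. Unit := fun i => (a.out.1 i).bind fun x => (b.out.1 i).bind fun y => g (x, y)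
  have hf : Partrec f := by
    refine ka.bind (Partrec.bind (kb.comp Computable.fst) (hg.comp ?_))
    exact (Computable.snd.comp Computable.fst).pair Computable.snd
  have hW : REPred (fun i => i ∈ {i | (f i).Dom}) := by
    refine Partrec.of_eq hf fun i => ?_
    apply Part.ext
    intro u
    rw [Part.mem_assert_iff]
    constructor
    · intro hu
      exact ⟨Part.dom_iff_mem.2 ⟨u, hu⟩, Part.mem_some _⟩
    · rintro ⟨hd, -⟩
      exact Part.get_mem (show (f i).Dom from hd)
  have key : ∀ᶠ i in C.ae, ((f i).Dom ↔ a.val i = b.val i) := by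
    filter_upwards [a.val_mem, b.val_mem] with i h1 h2
    have e1 := Part.eq_some_iff.2 h1
    have e2 := Part.eq_some_iff.2 h2
    simp only [f, e1, e2, Part.bind_some, g]
    by_cases h : a.val i = b.val i <;> simp [h]
  rcases C.cohesive _ hW with h | h
  · left
    replace h := (C.eventually_iff (fun i => (f i).Dom)).2 h
    apply HyperNat.ext_val
    filter_upwards [h, key] with i h1 h2
    exact h2.1 h1
  · right
    replace h := (C.eventually_iff (fun i => ¬ (f i).Dom)).2 h
    filter_upwards [h, key] with i h1 h2 h3
    exact h1 (h2.2 h3)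

/-! ### Uniformly computable sequences of structures -/

/-- A uniformly computable sequence of sets: `A i` is identified, through the injection `code i`,
with a subset of `ω` that is computable uniformly in `i`. -/
structure UCFamily (A : ℕ → Type*) where
  code : ∀ i, A i → ℕ
  inj : ∀ i, Function.Injective (code i)
  dom : ComputablePred fun p : ℕ × ℕ => p.2 ∈ Set.range (code p.1)

/-- The maps `g i : A i → B i` are uniformly computable on codes. -/
def UComp₁ {A B : ℕ → Type*} (a : ∀ i, A i → ℕ) (b : ∀ i, B i → ℕ)
    (g : ∀ i, A i → B i) : Prop :=
  ∃ f : ℕ × ℕ → ℕ, Computable f ∧ ∀ i x, f (i, a i x) = b i (g i x)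

/-- The maps `g i : A i → B i → D i` are uniformly computable on codes. -/
def UComp₂ {A B D : ℕ → Type*} (a : ∀ i, A i → ℕ) (b : ∀ i, B i → ℕ) (d : ∀ i, D i → ℕ)
    (g : ∀ i, A i → B i → D i) : Prop :=
  ∃ f : ℕ × ℕ × ℕ → ℕ, Computable f ∧ ∀ i x y, f (i, a i x, b i y) = d i (g i x y)

/-- A uniformly computable sequence of fields. -/
structure UCField (A : ℕ → Type*) [∀ i, Field (A i)] extends UCFamily A where
  zero : Computable fun i => code i 0
  one : Computable fun i => code i 1
  add : UComp₂ code code code fun _ x y => x + y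
  mul : UComp₂ code code code fun _ x y => x * y

/-- A uniformly computable sequence of groups. -/
structure UCGroup (A : ℕ → Type*) [∀ i, Group (A i)] extends UCFamily A where
  one : Computable fun i => code i 1
  mul : UComp₂ code code code fun _ x y => x * y

/-- Unbounded search in a uniformly computable domain for the unique element that passes a
computable test. -/
theorem AEComp.search {C : CohesiveSet} {A : ℕ → Type*} (P : UCFamily A) {n u : ℕ → ℕ}
    (hn : AEComp C n) (hu : AEComp C u) {t : ℕ × ℕ × ℕ → Bool} (ht : Computable t)
    (s : ∀ i, A (n i)) (hs : ∀ᶠ i in C.ae, ∀ y, t (n i, u i, P.code (n i) y) = true ↔ y = s i) :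
    AEComp C fun i => P.code (n i) (s i) := by
  obtain ⟨hd, hd'⟩ := P.dom
  let p : ℕ × ℕ × ℕ → ℕ → Bool := fun q y =>
    (@decide _ (hd (q.1, y))) && t (q.1, q.2.1, y)
  have hp : Computable₂ p := by
    refine Primrec.and.to_comp.comp (hd'.comp ?_) (ht.comp ?_)
    · exact (Computable.fst.comp Computable.fst).pair Computable.snd
    · exact (Computable.fst.comp Computable.fst).pair
        ((Computable.fst.comp (Computable.snd.comp Computable.fst)).pair Computable.snd)
  refine hn.bind₃ hu hu (f := fun q => Nat.rfind fun y => Part.some (p q y))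
    (Partrec.rfind hp.partrec₂) ?_
  filter_upwards [hs] with i hi
  have key : ∀ y, p (n i, u i, u i) y = true ↔ y = P.code (n i) (s i) := by
    intro y
    simp only [p, Bool.and_eq_true, decide_eq_true_eq]
    constructor
    · rintro ⟨⟨x, rfl⟩, h⟩
      rw [(hi x).1 h]
    · rintro rfl
      exact ⟨⟨_, rfl⟩, (hi _).2 rfl⟩
  refine Nat.mem_rfind.2 ⟨?_, fun {m} hm => ?_⟩
  · have := (key _).2 rfl
    simp [this]
  · have h1 : p (n i, u i, u i) m = false := by
      rw [← Bool.not_eq_true, key]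
      exact hm.ne
    simp [h1]

/-! ### Cohesive products -/

/-- The cohesive product `∏_{C,N} A_i = ∏_C A_{N(i)}` of a uniformly computable sequence: the
classes `[φ]` such that `φ i` is, for almost every `i`, defined and an element of (the domain of)
`A_{N(i)}`. The product `∏_C A_i` is the case where `N` is the class of the identity. -/
def CohProd (C : CohesiveSet) {A : ℕ → Type*} (P : UCFamily A) (N : HyperNat C) : Type :=
  {a : HyperNat C // ∀ᶠ i in C.ae, a.val i ∈ Set.range (P.code (N.val i))}

namespace CohProd

variable {C : CohesiveSet} {A : ℕ → Type*} {P : UCFamily A} {N : HyperNat C}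

/-- The entries of an element of a cohesive product, with an arbitrary value at the (negligible)
places where the representative is undefined or takes its value outside of the domain. -/
def sec [∀ i, Nonempty (A i)] (a : CohProd C P N) (i : ℕ) : A (N.val i) :=
  open scoped Classical in
  if h : a.1.val i ∈ Set.range (P.code (N.val i)) then h.choose else Classical.arbitrary _

theorem code_sec [∀ i, Nonempty (A i)] (a : CohProd C P N) :
    ∀ᶠ i in C.ae, P.code (N.val i) (a.sec i) = a.1.val i := by
  filter_upwards [a.2] with i hi
  rw [sec, dif_pos hi]
  exact hi.choose_spec

theorem aeComp [∀ i, Nonempty (A i)] (a : CohProd C P N) :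
    AEComp C fun i => P.code (N.val i) (a.sec i) :=
  a.1.aeComp.congr a.code_sec

theorem ext_sec [∀ i, Nonempty (A i)] {a b : CohProd C P N}
    (h : ∀ᶠ i in C.ae, a.sec i = b.sec i) : a = b := by
  apply Subtype.ext
  apply HyperNat.ext_val
  filter_upwards [h, a.code_sec, b.code_sec] with i h1 h2 h3
  rw [← h2, ← h3, h1]

/-- The element of the cohesive product with the entries `s i`, where these agree almost
everywhere with a partial computable function. -/
def ofSec (s : ∀ i, A (N.val i)) (h : AEComp C fun i => P.code (N.val i) (s i)) :
    CohProd C P N :=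
  ⟨h.toHyperNat, by filter_upwards [h.val_toHyperNat] with i hi; rw [hi]; exact ⟨_, rfl⟩⟩

theorem sec_ofSec [∀ i, Nonempty (A i)] (s : ∀ i, A (N.val i))
    (h : AEComp C fun i => P.code (N.val i) (s i)) :
    ∀ᶠ i in C.ae, (ofSec (P := P) s h).sec i = s i := by
  filter_upwards [(ofSec (P := P) s h).code_sec, h.val_toHyperNat] with i h1 h2
  exact P.inj _ (h1.trans h2)

theorem eq_or_ne [∀ i, Nonempty (A i)] (a b : CohProd C P N) :
    a = b ∨ ∀ᶠ i in C.ae, a.sec i ≠ b.sec i := by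
  rcases HyperNat.eq_or_ne a.1 b.1 with h | h
  · exact Or.inl (Subtype.ext h)
  · right
    filter_upwards [h, a.code_sec, b.code_sec] with i h1 h2 h3 h4
    rw [← h2, ← h3, h4] at h1
    exact h1 rfl

end CohProd

/-! #### Cohesive products of groups -/

namespace CohProd

section group

variable {C : CohesiveSet} {A : ℕ → Type*} [∀ i, Group (A i)] {P : UCGroup A} {N : HyperNat C}

instance : One (CohProd C P.toUCFamily N) :=
  ⟨ofSec (fun _ => 1) (N.aeComp.map₁ P.one (Eventually.of_forall fun _ => rfl))⟩

instance : Mul (CohProd C P.toUCFamily N) :=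
  ⟨fun a b => ofSec (fun i => a.sec i * b.sec i) (N.aeComp.map₃ a.aeComp b.aeComp
    P.mul.choose_spec.1 (Eventually.of_forall fun _ => (P.mul.choose_spec.2 _ _ _).symm))⟩

instance : Inv (CohProd C P.toUCFamily N) :=
  ⟨fun a => ofSec (fun i => (a.sec i)⁻¹) (by
    obtain ⟨f, hf, hf'⟩ := P.mul
    refine AEComp.search P.toUCFamily N.aeComp a.aeComp
      (t := fun q => decide (f (q.1, q.2.1, q.2.2) = P.code q.1 1)) ?_ _ ?_
    · exact (Primrec.eq (α := ℕ)).decide.to_comp.comp hf (P.one.comp Computable.fst)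
    · refine Eventually.of_forall fun i y => ?_
      simp only [hf', decide_eq_true_eq, (P.inj _).eq_iff]
      exact mul_eq_one_iff_eq_inv'.trans Iff.rfl)⟩

theorem sec_one : ∀ᶠ i in C.ae, (1 : CohProd C P.toUCFamily N).sec i = 1 := sec_ofSec _ _
theorem sec_mul (a b : CohProd C P.toUCFamily N) :
    ∀ᶠ i in C.ae, (a * b).sec i = a.sec i * b.sec i := sec_ofSec _ _
theorem sec_inv (a : CohProd C P.toUCFamily N) :
    ∀ᶠ i in C.ae, (a⁻¹).sec i = (a.sec i)⁻¹ := sec_ofSec _ _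

instance : Group (CohProd C P.toUCFamily N) :=
  Group.ofLeftAxioms
    (fun a b c => ext_sec (by
      filter_upwards [sec_mul (a * b) c, sec_mul a b, sec_mul a (b * c), sec_mul b c]
        with i h1 h2 h3 h4
      rw [h1, h2, h3, h4, mul_assoc]))
    (fun a => ext_sec (by
      filter_upwards [sec_mul 1 a, sec_one (P := P) (N := N)] with i h1 h2
      rw [h1, h2, one_mul]))
    (fun a => ext_sec (by
      filter_upwards [sec_mul a⁻¹ a, sec_inv a, sec_one (P := P) (N := N)] with i h1 h2 h3
      rw [h1, h2, h3, inv_mul_cancel]))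

end group

/-! #### Cohesive products of fields -/

section field

variable {C : CohesiveSet} {A : ℕ → Type*} [∀ i, Field (A i)] {P : UCField A} {N : HyperNat C}

instance : Zero (CohProd C P.toUCFamily N) :=
  ⟨ofSec (fun _ => 0) (N.aeComp.map₁ P.zero (Eventually.of_forall fun _ => rfl))⟩

instance fieldOne : One (CohProd C P.toUCFamily N) :=
  ⟨ofSec (fun _ => 1) (N.aeComp.map₁ P.one (Eventually.of_forall fun _ => rfl))⟩

instance : Add (CohProd C P.toUCFamily N) :=
  ⟨fun a b => ofSec (fun i => a.sec i + b.sec i) (N.aeComp.map₃ a.aeComp b.aeComp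
    P.add.choose_spec.1 (Eventually.of_forall fun _ => (P.add.choose_spec.2 _ _ _).symm))⟩

instance fieldMul : Mul (CohProd C P.toUCFamily N) :=
  ⟨fun a b => ofSec (fun i => a.sec i * b.sec i) (N.aeComp.map₃ a.aeComp b.aeComp
    P.mul.choose_spec.1 (Eventually.of_forall fun _ => (P.mul.choose_spec.2 _ _ _).symm))⟩

instance : Neg (CohProd C P.toUCFamily N) :=
  ⟨fun a => ofSec (fun i => -(a.sec i)) (by
    obtain ⟨f, hf, hf'⟩ := P.add
    refine AEComp.search P.toUCFamily N.aeComp a.aeComp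
      (t := fun q => decide (f (q.1, q.2.1, q.2.2) = P.code q.1 0)) ?_ _ ?_
    · exact (Primrec.eq (α := ℕ)).decide.to_comp.comp hf (P.zero.comp Computable.fst)
    · refine Eventually.of_forall fun i y => ?_
      simp only [hf', decide_eq_true_eq, (P.inj _).eq_iff]
      exact add_eq_zero_iff_eq_neg'.trans Iff.rfl)⟩

instance fieldInv : Inv (CohProd C P.toUCFamily N) :=
  ⟨fun a => ofSec (fun i => (a.sec i)⁻¹) (by
    obtain ⟨f, hf, hf'⟩ := P.mul
    refine AEComp.search P.toUCFamily N.aeComp a.aeComp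
      (t := fun q => bif decide (q.2.1 = P.code q.1 0) then decide (q.2.2 = P.code q.1 0)
        else decide (f (q.1, q.2.1, q.2.2) = P.code q.1 1)) ?_ _ ?_
    · refine Computable.cond ?_ ?_ ?_
      · exact (Primrec.eq (α := ℕ)).decide.to_comp.comp (Computable.fst.comp Computable.snd)
          (P.zero.comp Computable.fst)
      · exact (Primrec.eq (α := ℕ)).decide.to_comp.comp (Computable.snd.comp Computable.snd)
          (P.zero.comp Computable.fst)
      · exact (Primrec.eq (α := ℕ)).decide.to_comp.comp hf (P.one.comp Computable.fst)
    · refine Eventually.of_forall fun i y => ?_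
      by_cases h : a.sec i = 0
      · simp [h, (P.inj _).eq_iff]
      · simp only [hf', (P.inj _).eq_iff, h, decide_false, cond_false, decide_eq_true_eq]
        rw [mul_comm]
        exact mul_eq_one_iff_eq_inv₀ h)⟩

theorem sec_zero : ∀ᶠ i in C.ae, (0 : CohProd C P.toUCFamily N).sec i = 0 := sec_ofSec _ _
theorem sec_fieldOne : ∀ᶠ i in C.ae, (1 : CohProd C P.toUCFamily N).sec i = 1 := sec_ofSec _ _
theorem sec_add (a b : CohProd C P.toUCFamily N) :
    ∀ᶠ i in C.ae, (a + b).sec i = a.sec i + b.sec i := sec_ofSec _ _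
theorem sec_fieldMul (a b : CohProd C P.toUCFamily N) :
    ∀ᶠ i in C.ae, (a * b).sec i = a.sec i * b.sec i := sec_ofSec _ _
theorem sec_neg (a : CohProd C P.toUCFamily N) :
    ∀ᶠ i in C.ae, (-a).sec i = -(a.sec i) := sec_ofSec _ _
theorem sec_fieldInv (a : CohProd C P.toUCFamily N) :
    ∀ᶠ i in C.ae, (a⁻¹).sec i = (a.sec i)⁻¹ := sec_ofSec _ _

instance : CommRing (CohProd C P.toUCFamily N) where
  add_assoc a b c := ext_sec (by
    filter_upwards [sec_add (a + b) c, sec_add a b, sec_add a (b + c), sec_add b c]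
      with i h1 h2 h3 h4
    rw [h1, h2, h3, h4, add_assoc])
  zero_add a := ext_sec (by
    filter_upwards [sec_add 0 a, sec_zero (P := P) (N := N)] with i h1 h2
    rw [h1, h2, zero_add])
  add_zero a := ext_sec (by
    filter_upwards [sec_add a 0, sec_zero (P := P) (N := N)] with i h1 h2
    rw [h1, h2, add_zero])
  add_comm a b := ext_sec (by
    filter_upwards [sec_add a b, sec_add b a] with i h1 h2
    rw [h1, h2, add_comm])
  neg_add_cancel a := ext_sec (by
    filter_upwards [sec_add (-a) a, sec_neg a, sec_zero (P := P) (N := N)] with i h1 h2 h3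
    rw [h1, h2, h3, neg_add_cancel])
  mul_assoc a b c := ext_sec (by
    filter_upwards [sec_fieldMul (a * b) c, sec_fieldMul a b, sec_fieldMul a (b * c),
      sec_fieldMul b c] with i h1 h2 h3 h4
    rw [h1, h2, h3, h4, mul_assoc])
  mul_comm a b := ext_sec (by
    filter_upwards [sec_fieldMul a b, sec_fieldMul b a] with i h1 h2
    rw [h1, h2, mul_comm])
  one_mul a := ext_sec (by
    filter_upwards [sec_fieldMul 1 a, sec_fieldOne (P := P) (N := N)] with i h1 h2
    rw [h1, h2, one_mul])
  mul_one a := ext_sec (by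
    filter_upwards [sec_fieldMul a 1, sec_fieldOne (P := P) (N := N)] with i h1 h2
    rw [h1, h2, mul_one])
  left_distrib a b c := ext_sec (by
    filter_upwards [sec_fieldMul a (b + c), sec_add b c, sec_add (a * b) (a * c),
      sec_fieldMul a b, sec_fieldMul a c] with i h1 h2 h3 h4 h5
    rw [h1, h2, h3, h4, h5, mul_add])
  right_distrib a b c := ext_sec (by
    filter_upwards [sec_fieldMul (a + b) c, sec_add a b, sec_add (a * c) (b * c),
      sec_fieldMul a c, sec_fieldMul b c] with i h1 h2 h3 h4 h5
    rw [h1, h2, h3, h4, h5, add_mul])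
  zero_mul a := ext_sec (by
    filter_upwards [sec_fieldMul 0 a, sec_zero (P := P) (N := N)] with i h1 h2
    rw [h1, h2, zero_mul])
  mul_zero a := ext_sec (by
    filter_upwards [sec_fieldMul a 0, sec_zero (P := P) (N := N)] with i h1 h2
    rw [h1, h2, mul_zero])
  nsmul := nsmulRec
  zsmul := zsmulRec

instance : Field (CohProd C P.toUCFamily N) where
  exists_pair_ne := ⟨0, 1, fun h => by
    have h0 := sec_zero (P := P) (N := N)
    rw [h] at h0
    obtain ⟨i, h1, h2⟩ := (h0.and (sec_fieldOne (P := P) (N := N))).exists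
    exact zero_ne_one (h1.symm.trans h2)⟩
  mul_inv_cancel a ha := ext_sec (by
    filter_upwards [(eq_or_ne a 0).resolve_left ha, sec_zero (P := P) (N := N),
      sec_fieldMul a a⁻¹, sec_fieldInv a, sec_fieldOne (P := P) (N := N)] with i h1 h2 h3 h4 h5
    rw [h2] at h1
    rw [h3, h4, h5, mul_inv_cancel₀ h1])
  inv_zero := ext_sec (by
    filter_upwards [sec_fieldInv (0 : CohProd C P.toUCFamily N), sec_zero (P := P) (N := N)]
      with i h1 h2
    rw [h1, h2, inv_zero])
  nnqsmul := _
  nnqsmul_def := fun _ _ => rfl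
  qsmul := _
  qsmul_def := fun _ _ => rfl

end field

end CohProd

/-! ### Projective limits -/

/-- The projective limit of an inverse system of groups `f_{m,n} : G m → G n`, `n < m`, as a
subgroup of the product. -/
def projLim {I : Type*} [LT I] (G : I → Type*) [∀ i, Group (G i)]
    (f : ∀ ⦃n m : I⦄, n < m → G m →* G n) : Subgroup (∀ i, G i) where
  carrier := {g | ∀ ⦃n m : I⦄ (h : n < m), f h (g m) = g n}
  one_mem' := fun n m h => by simp
  mul_mem' := fun ha hb n m h => by simp [ha h, hb h]
  inv_mem' := fun ha n m h => by simp [ha h]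

/-! ### Fully computable Galois extensions -/

/-- The quotient map `Gal(L/F) → Gal(E/F)`, restriction to `E`, for `E ≤ L` with `E/F` normal. -/
def galRes {F K : Type*} [Field F] [Field K] [Algebra F K] {E L : IntermediateField F K}
    [Normal F E] (h : E ≤ L) : (L ≃ₐ[F] L) →* (E ≃ₐ[F] E) :=
  letI : Algebra E L := (IntermediateField.inclusion h).toAlgebra
  haveI : IsScalarTower F E L := IsScalarTower.of_algebraMap_eq fun _ => rfl
  AlgEquiv.restrictNormalHom E

theorem coe_galRes {F K : Type*} [Field F] [Field K] [Algebra F K] {E L : IntermediateField F K}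
    [Normal F E] (h : E ≤ L) (g : L ≃ₐ[F] L) (x : E) :
    ((galRes h g x : E) : K) = (g (IntermediateField.inclusion h x) : K) := by
  let : Algebra E L := (IntermediateField.inclusion h).toAlgebra
  have : IsScalarTower F E L := IsScalarTower.of_algebraMap_eq fun _ => rfl
  exact congrArg Subtype.val (AlgEquiv.restrictNormal_commutes g E x)

/-- A fully computable (infinite) Galois extension `K/F`: computable presentations of `F`, `K`, a
strictly increasing exhaustion of `K` by finite Galois subextensions `L i`, and presentations of
the fields `L i` and of the Galois groups `Gal(L i/F)`, uniformly computable together with the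
embeddings, the quotient maps of the Galois groups, and the Galois actions. -/
structure FullyComputable (F K : Type*) [Field F] [Field K] [Algebra F K] where
  /-- `K/F` is Galois. -/
  galois : IsGalois F K
  /-- A computable presentation of `F` (a uniformly computable constant sequence, with the same
  coding at every index), and of `K`. -/
  presF : UCField fun _ : ℕ => F
  presF_const : ∀ i j, presF.code i = presF.code j
  presK : UCField fun _ : ℕ => K
  presK_const : ∀ i j, presK.code i = presK.code j
  /-- The embedding `F → K` is computable. -/
  embF : UComp₁ presF.code presK.code fun _ x => algebraMap F K x
  /-- The finite Galois subextensions `K_i`. -/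
  L : ℕ → IntermediateField F K
  finite : ∀ i, FiniteDimensional F (L i)
  isGalois : ∀ i, IsGalois F (L i)
  lt_succ : ∀ i, L i < L (i + 1)
  exhaust : ∀ x : K, ∃ i, x ∈ L i
  presL : UCField fun i => L i
  /-- The embeddings `K_i → K` and `K_i → K_{i+1}` are uniformly computable. -/
  embL : UComp₁ presL.code presK.code fun _ x => (x : K)
  embSucc : UComp₁ (B := fun i => L (i + 1)) presL.code (fun i => presL.code (i + 1))
    fun i x => IntermediateField.inclusion (lt_succ i).le x
  /-- The groups `G_i = Gal(K_i/F)` are uniformly computable. -/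
  presG : UCGroup fun i => L i ≃ₐ[F] L i
  /-- The quotient maps `G_m → G_n`, for `n < m`, are uniformly computable. -/
  quot : ∃ f : ℕ × ℕ × ℕ → ℕ, Computable f ∧ ∀ (n m : ℕ) (h : n < m) (g : L m ≃ₐ[F] L m),
    f (n, m, presG.code m g) = presG.code n (galRes (strictMono_nat_of_lt_succ lt_succ h).le g)
  /-- The actions of `G_i` on `K_i` are uniformly computable. -/
  act : UComp₂ presG.code presL.code presL.code fun _ g x => g x

namespace FullyComputable

variable {F K : Type*} [Field F] [Field K] [Algebra F K] (D : FullyComputable F K)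
  (C : CohesiveSet)

theorem strictMono : StrictMono D.L := strictMono_nat_of_lt_succ D.lt_succ

instance (i : ℕ) : IsGalois F (D.L i) := D.isGalois i

/-- `∏_C F`. -/
abbrev baseProd : Type := CohProd C D.presF.toUCFamily (HyperNat.id C)

/-- `∏_{C,N} K_i`. -/
abbrev fieldProd (N : HyperNat C) : Type := CohProd C D.presL.toUCFamily N

/-- `∏_{C,N} G_i`. -/
abbrev groupProd (N : HyperNat C) : Type := CohProd C D.presG.toUCFamily N

variable {C}

theorem aeComp_algebraMap {N : HyperNat C} (a : D.baseProd C) :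
    AEComp C fun i => D.presL.code (N.val i) (algebraMap F (D.L (N.val i)) (a.sec i)) := by
  obtain ⟨f, hf, hf'⟩ := D.embF
  obtain ⟨k, hk, hk'⟩ := D.embL
  refine AEComp.search D.presL.toUCFamily (u := fun i => D.presF.code 0 (a.sec i)) N.aeComp
    (a.aeComp.congr (Eventually.of_forall fun i => by rw [D.presF_const 0]))
    (t := fun q => decide (k (q.1, q.2.2) = f (0, q.2.1))) ?_ _ ?_
  · exact (Primrec.eq (α := ℕ)).decide.to_comp.comp
      (hk.comp (Computable.fst.pair (Computable.snd.comp Computable.snd)))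
      (hf.comp ((Computable.const 0).pair (Computable.fst.comp Computable.snd)))
  · refine Eventually.of_forall fun i y => ?_
    simp only [decide_eq_true_eq, hk', hf', D.presK_const (N.val i) 0, (D.presK.inj _).eq_iff]
    exact ⟨fun h => Subtype.ext h, fun h => congrArg Subtype.val h⟩

/-- The embedding of `∏_C F` into `∏_{C,N} K_i`, entry by entry. -/
def baseEmb (N : HyperNat C) : D.baseProd C →+* D.fieldProd C N where
  toFun a := CohProd.ofSec (fun i => algebraMap F (D.L (N.val i)) (a.sec i))
    (D.aeComp_algebraMap a)
  map_one' := CohProd.ext_sec (by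
    filter_upwards [CohProd.sec_ofSec (P := D.presL.toUCFamily) _
      (D.aeComp_algebraMap (N := N) (1 : D.baseProd C)),
      CohProd.sec_fieldOne (P := D.presF) (N := HyperNat.id C),
      CohProd.sec_fieldOne (P := D.presL) (N := N)] with i h1 h2 h3
    rw [h1, h2, h3, map_one])
  map_zero' := CohProd.ext_sec (by
    filter_upwards [CohProd.sec_ofSec (P := D.presL.toUCFamily) _
      (D.aeComp_algebraMap (N := N) (0 : D.baseProd C)),
      CohProd.sec_zero (P := D.presF) (N := HyperNat.id C),
      CohProd.sec_zero (P := D.presL) (N := N)] with i h1 h2 h3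
    rw [h1, h2, h3, map_zero])
  map_add' a b := CohProd.ext_sec (by
    filter_upwards [CohProd.sec_ofSec (P := D.presL.toUCFamily) _
      (D.aeComp_algebraMap (N := N) (a + b)),
      CohProd.sec_ofSec (P := D.presL.toUCFamily) _ (D.aeComp_algebraMap (N := N) a),
      CohProd.sec_ofSec (P := D.presL.toUCFamily) _ (D.aeComp_algebraMap (N := N) b),
      CohProd.sec_add a b,
      CohProd.sec_add (CohProd.ofSec (P := D.presL.toUCFamily) _ (D.aeComp_algebraMap (N := N) a))
        (CohProd.ofSec (P := D.presL.toUCFamily) _ (D.aeComp_algebraMap (N := N) b))]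
      with i h1 h2 h3 h4 h5
    rw [h1, h4, h5, h2, h3, map_add])
  map_mul' a b := CohProd.ext_sec (by
    filter_upwards [CohProd.sec_ofSec (P := D.presL.toUCFamily) _
      (D.aeComp_algebraMap (N := N) (a * b)),
      CohProd.sec_ofSec (P := D.presL.toUCFamily) _ (D.aeComp_algebraMap (N := N) a),
      CohProd.sec_ofSec (P := D.presL.toUCFamily) _ (D.aeComp_algebraMap (N := N) b),
      CohProd.sec_fieldMul a b,
      CohProd.sec_fieldMul
        (CohProd.ofSec (P := D.presL.toUCFamily) _ (D.aeComp_algebraMap (N := N) a))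
        (CohProd.ofSec (P := D.presL.toUCFamily) _ (D.aeComp_algebraMap (N := N) b))]
      with i h1 h2 h3 h4 h5
    rw [h1, h4, h5, h2, h3, map_mul])

instance (N : HyperNat C) : Algebra (D.baseProd C) (D.fieldProd C N) := (D.baseEmb N).toAlgebra

theorem sec_algebraMap (N : HyperNat C) (a : D.baseProd C) : ∀ᶠ i in C.ae,
    (algebraMap (D.baseProd C) (D.fieldProd C N) a).sec i
      = algebraMap F (D.L (N.val i)) (a.sec i) :=
  CohProd.sec_ofSec _ _

/-! #### The inclusions `∏_{C,N} K_i → ∏_{C,M} K_i` -/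

/-- The entrywise inclusion `K_n ⊆ K_m` (for `n ≤ m`, and arbitrary otherwise). -/
def stepIncl (n m : ℕ) (x : D.L n) : D.L m :=
  open scoped Classical in
  if h : n ≤ m then IntermediateField.inclusion (D.strictMono.monotone h) x else 0

theorem coe_stepIncl {n m : ℕ} (h : n ≤ m) (x : D.L n) : (D.stepIncl n m x : K) = x := by
  rw [stepIncl, dif_pos h]; rfl

theorem aeComp_incl {N M : HyperNat C} (h : N < M) (a : D.fieldProd C N) :
    AEComp C fun i => D.presL.code (M.val i) (D.stepIncl (N.val i) (M.val i) (a.sec i)) := by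
  obtain ⟨k, hk, hk'⟩ := D.embL
  have hu : AEComp C fun i => D.presK.code 0 (a.sec i : K) :=
    N.aeComp.map₂ a.aeComp hk (Eventually.of_forall fun i => by
      rw [hk', D.presK_const (N.val i) 0])
  refine AEComp.search D.presL.toUCFamily M.aeComp hu
    (t := fun q => decide (k (q.1, q.2.2) = q.2.1)) ?_ _ ?_
  · exact (Primrec.eq (α := ℕ)).decide.to_comp.comp
      (hk.comp (Computable.fst.pair (Computable.snd.comp Computable.snd)))
      (Computable.fst.comp Computable.snd)
  · filter_upwards [h] with i hi y
    simp only [decide_eq_true_eq, hk', D.presK_const (M.val i) 0, (D.presK.inj _).eq_iff]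
    rw [← D.coe_stepIncl hi.le (a.sec i)]
    exact Subtype.ext_iff.symm

theorem sec_incl {N M : HyperNat C} (h : N < M) (a : D.fieldProd C N) : ∀ᶠ i in C.ae,
    (((CohProd.ofSec (P := D.presL.toUCFamily) _ (D.aeComp_incl h a)).sec i : D.L (M.val i)) : K)
      = a.sec i := by
  filter_upwards [CohProd.sec_ofSec (P := D.presL.toUCFamily) _ (D.aeComp_incl h a), h] with i h1 h2
  rw [h1, D.coe_stepIncl h2.le]

/-- The inclusion `∏_{C,N} K_i → ∏_{C,M} K_i` for `N < M`, induced by `K_n ⊆ K_m` for `n < m`. -/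
def incl {N M : HyperNat C} (h : N < M) : D.fieldProd C N →ₐ[D.baseProd C] D.fieldProd C M where
  toFun a := CohProd.ofSec _ (D.aeComp_incl h a)
  map_one' := CohProd.ext_sec (by
    filter_upwards [D.sec_incl h 1, CohProd.sec_fieldOne (P := D.presL) (N := N),
      CohProd.sec_fieldOne (P := D.presL) (N := M)] with i h1 h2 h3
    apply Subtype.ext
    rw [h1, h2, h3]; rfl)
  map_zero' := CohProd.ext_sec (by
    filter_upwards [D.sec_incl h 0, CohProd.sec_zero (P := D.presL) (N := N),
      CohProd.sec_zero (P := D.presL) (N := M)] with i h1 h2 h3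
    apply Subtype.ext
    rw [h1, h2, h3]; rfl)
  map_add' a b := CohProd.ext_sec (by
    filter_upwards [D.sec_incl h (a + b), D.sec_incl h a, D.sec_incl h b, CohProd.sec_add a b,
      CohProd.sec_add (CohProd.ofSec _ (D.aeComp_incl h a)) (CohProd.ofSec _ (D.aeComp_incl h b))]
      with i h1 h2 h3 h4 h5
    apply Subtype.ext
    rw [h1, h4, h5]
    simp only [IntermediateField.coe_add, h2, h3])
  map_mul' a b := CohProd.ext_sec (by
    filter_upwards [D.sec_incl h (a * b), D.sec_incl h a, D.sec_incl h b, CohProd.sec_fieldMul a b,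
      CohProd.sec_fieldMul (CohProd.ofSec _ (D.aeComp_incl h a))
        (CohProd.ofSec _ (D.aeComp_incl h b))] with i h1 h2 h3 h4 h5
    apply Subtype.ext
    rw [h1, h4, h5]
    simp only [IntermediateField.coe_mul, h2, h3])
  commutes' r := CohProd.ext_sec (by
    filter_upwards [D.sec_incl h (algebraMap _ _ r), D.sec_algebraMap N r, D.sec_algebraMap M r]
      with i h1 h2 h3
    apply Subtype.ext
    rw [h1, h2, h3]; rfl)

theorem coe_sec_incl {N M : HyperNat C} (h : N < M) (a : D.fieldProd C N) : ∀ᶠ i in C.ae,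
    ((D.incl h a).sec i : K) = a.sec i := D.sec_incl h a

/-! #### The quotient maps `f_{M,N} : ∏_{C,M} G_i → ∏_{C,N} G_i` -/

/-- The quotient map `G_m → G_n` (for `n < m`, and trivial otherwise). -/
def stepRes (n m : ℕ) : (D.L m ≃ₐ[F] D.L m) →* (D.L n ≃ₐ[F] D.L n) :=
  open scoped Classical in if h : n < m then galRes (D.strictMono h).le else 1

theorem aeComp_res {N M : HyperNat C} (h : N < M) (g : D.groupProd C M) :
    AEComp C fun i => D.presG.code (N.val i) (D.stepRes (N.val i) (M.val i) (g.sec i)) := by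
  obtain ⟨f, hf, hf'⟩ := D.quot
  refine N.aeComp.map₃ M.aeComp g.aeComp hf ?_
  filter_upwards [h] with i hi
  rw [hf' _ _ hi, stepRes, dif_pos hi]

/-- `f_{M,N}`, given by `f_{M,N}(g)(i) = f_{M(i),N(i)}(g(i))`. -/
def res {N M : HyperNat C} (h : N < M) : D.groupProd C M →* D.groupProd C N :=
  MonoidHom.mk' (fun g => CohProd.ofSec _ (D.aeComp_res h g)) fun a b => CohProd.ext_sec (by
    filter_upwards [CohProd.sec_ofSec (P := D.presG.toUCFamily) _ (D.aeComp_res h (a * b)),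
      CohProd.sec_ofSec (P := D.presG.toUCFamily) _ (D.aeComp_res h a),
      CohProd.sec_ofSec (P := D.presG.toUCFamily) _ (D.aeComp_res h b),
      CohProd.sec_mul a b, CohProd.sec_mul (CohProd.ofSec _ (D.aeComp_res h a))
        (CohProd.ofSec _ (D.aeComp_res h b))] with i h1 h2 h3 h4 h5
    rw [h1, h4, h5, h2, h3, map_mul])

theorem sec_res {N M : HyperNat C} (h : N < M) (g : D.groupProd C M) : ∀ᶠ i in C.ae,
    (D.res h g).sec i = D.stepRes (N.val i) (M.val i) (g.sec i) := CohProd.sec_ofSec _ _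

/-! #### The action of `∏_{C,N} G_i` on `∏_{C,N} K_i` -/

theorem aeComp_act {N : HyperNat C} (g : D.groupProd C N) (a : D.fieldProd C N) :
    AEComp C fun i => D.presL.code (N.val i) (g.sec i (a.sec i)) := by
  obtain ⟨f, hf, hf'⟩ := D.act
  exact N.aeComp.map₃ g.aeComp a.aeComp hf (Eventually.of_forall fun _ => (hf' _ _ _).symm)

/-- `[σ][α] = [σ(α)]`, entry by entry. -/
def actFun {N : HyperNat C} (g : D.groupProd C N) (a : D.fieldProd C N) : D.fieldProd C N :=
  CohProd.ofSec _ (D.aeComp_act g a)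

theorem sec_actFun {N : HyperNat C} (g : D.groupProd C N) (a : D.fieldProd C N) :
    ∀ᶠ i in C.ae, (D.actFun g a).sec i = g.sec i (a.sec i) := CohProd.sec_ofSec _ _

theorem actFun_one {N : HyperNat C} (a : D.fieldProd C N) : D.actFun 1 a = a :=
  CohProd.ext_sec (by
    filter_upwards [D.sec_actFun 1 a, CohProd.sec_one (P := D.presG) (N := N)] with i h1 h2
    rw [h1, h2]; rfl)

theorem actFun_mul {N : HyperNat C} (g h : D.groupProd C N) (a : D.fieldProd C N) :
    D.actFun (g * h) a = D.actFun g (D.actFun h a) :=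
  CohProd.ext_sec (by
    filter_upwards [D.sec_actFun (g * h) a, D.sec_actFun g (D.actFun h a), D.sec_actFun h a,
      CohProd.sec_mul g h] with i h1 h2 h3 h4
    rw [h1, h2, h3, h4]; rfl)

/-- The automorphism of `∏_{C,N} K_i` over `∏_C F` given by an element of `∏_{C,N} G_i`. -/
def actEquiv {N : HyperNat C} (g : D.groupProd C N) :
    D.fieldProd C N ≃ₐ[D.baseProd C] D.fieldProd C N where
  toFun := D.actFun g
  invFun := D.actFun g⁻¹
  left_inv a := by rw [← D.actFun_mul, inv_mul_cancel, D.actFun_one]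
  right_inv a := by rw [← D.actFun_mul, mul_inv_cancel, D.actFun_one]
  map_add' a b := CohProd.ext_sec (by
    filter_upwards [D.sec_actFun g (a + b), D.sec_actFun g a, D.sec_actFun g b,
      CohProd.sec_add a b, CohProd.sec_add (D.actFun g a) (D.actFun g b)] with i h1 h2 h3 h4 h5
    rw [h1, h4, h5, h2, h3, map_add])
  map_mul' a b := CohProd.ext_sec (by
    filter_upwards [D.sec_actFun g (a * b), D.sec_actFun g a, D.sec_actFun g b,
      CohProd.sec_fieldMul a b, CohProd.sec_fieldMul (D.actFun g a) (D.actFun g b)]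
      with i h1 h2 h3 h4 h5
    rw [h1, h4, h5, h2, h3, map_mul])
  commutes' r := CohProd.ext_sec (by
    filter_upwards [D.sec_actFun g (algebraMap _ _ r), D.sec_algebraMap N r] with i h1 h2
    rw [h1, h2, AlgEquiv.commutes])

variable (C)

/-- `Alg(∏_{C,N} K_i)`, the algebraic part of `∏_{C,N} K_i` over `∏_C F`. -/
abbrev algPart (N : HyperNat C) : IntermediateField (D.baseProd C) (D.fieldProd C N) :=
  algebraicClosure (D.baseProd C) (D.fieldProd C N)

/-- `Gal(Alg(∏_{C,N} K_i)/∏_C F)`, with the Krull topology. -/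
abbrev galAlg (N : HyperNat C) : Type := Gal(D.algPart C N/D.baseProd C)

variable {C}

/-- `η_N : ∏_{C,N} G_i → Gal(Alg(∏_{C,N} K_i)/∏_C F)`, restriction of the action to the
algebraic part. -/
def eta (N : HyperNat C) : D.groupProd C N →* D.galAlg C N :=
  MonoidHom.mk' (fun g => algebraicClosure.algEquivOfAlgEquiv (D.actEquiv g)) fun a b => by
    apply AlgEquiv.ext
    intro x
    apply Subtype.ext
    exact D.actFun_mul a b x

theorem coe_eta {N : HyperNat C} (g : D.groupProd C N) (x : D.algPart C N) :
    ((D.eta N g x : D.algPart C N) : D.fieldProd C N) = D.actFun g x := rfl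

/-- The inclusion `Alg(∏_{C,N} K_i) → Alg(∏_{C,M} K_i)` for `N < M`. -/
def algIncl {N M : HyperNat C} (h : N < M) : D.algPart C N →ₐ[D.baseProd C] D.algPart C M :=
  ((D.incl h).comp (D.algPart C N).val).codRestrict (D.algPart C M).toSubalgebra
    fun x => (map_mem_algebraicClosure_iff (D.incl h)).2 x.2

theorem coe_algIncl {N M : HyperNat C} (h : N < M) (x : D.algPart C N) :
    ((D.algIncl h x : D.algPart C M) : D.fieldProd C M) = D.incl h x := rfl

theorem actFun_incl {N M : HyperNat C} (h : N < M) (g : D.groupProd C M) (a : D.fieldProd C N) :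
    D.actFun g (D.incl h a) = D.incl h (D.actFun (D.res h g) a) :=
  CohProd.ext_sec (by
    filter_upwards [D.sec_actFun g (D.incl h a), D.coe_sec_incl h a,
      D.coe_sec_incl h (D.actFun (D.res h g) a), D.sec_actFun (D.res h g) a, D.sec_res h g, h]
      with i h1 h2 h3 h4 h5 h6
    apply Subtype.ext
    rw [h1, h3, h4, h5, stepRes, dif_pos h6, coe_galRes]
    congr 2
    exact Subtype.ext h2)

theorem eta_algIncl {N M : HyperNat C} (h : N < M) (g : D.groupProd C M) (x : D.algPart C N) :
    D.eta M g (D.algIncl h x) = D.algIncl h (D.eta N (D.res h g) x) :=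
  Subtype.ext (D.actFun_incl h g x)

/-! #### The three projective limits over `N ∈ ∏_C ℕ` -/

variable (C)

/-- `lim_N ∏_{C,N} G_i`. -/
def limGroup : Subgroup (∀ N : HyperNat C, D.groupProd C N) :=
  projLim (D.groupProd C) fun _ _ h => D.res h

/-- `lim_N Gal(Alg(∏_{C,N} K_i)/∏_C F)`: the families `(σ_N)` such that, for `N < M`, the
restriction of `σ_M` to `Alg(∏_{C,N} K_i)` is `σ_N`. It carries the topology induced from the
product of the Krull topologies. -/
def limGal : Subgroup (∀ N : HyperNat C, D.galAlg C N) where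
  carrier := {σ | ∀ ⦃N M : HyperNat C⦄ (h : N < M) (x : D.algPart C N),
    σ M (D.algIncl h x) = D.algIncl h (σ N x)}
  one_mem' := fun _ _ _ _ => rfl
  mul_mem' := fun {a b} ha hb N M h x => by
    simp only [Pi.mul_apply, AlgEquiv.mul_apply]
    rw [hb h x, ha h]
  inv_mem' := fun {a} ha N M h x => by
    apply (a M).injective
    rw [ha h]
    simp only [Pi.inv_apply]
    change (a M * (a M)⁻¹) _ = D.algIncl h ((a N * (a N)⁻¹) x)
    simp

/-- The transition map `ker η_M → ker η_N` induced by `f_{M,N}`. -/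
def kerRes ⦃N M : HyperNat C⦄ (h : N < M) : (D.eta M).ker →* (D.eta N).ker :=
  ((D.res h).comp (D.eta M).ker.subtype).codRestrict (D.eta N).ker fun g => by
    rw [MonoidHom.mem_ker]
    apply AlgEquiv.ext
    intro x
    apply (D.algIncl h).injective
    have hg : D.eta M g.1 = 1 := g.2
    exact (D.eta_algIncl h g.1 x).symm.trans (by rw [hg]; rfl)

/-- `lim_N ker η_N`. -/
def limKer : Subgroup (∀ N : HyperNat C, (D.eta N).ker) :=
  projLim (fun N => (D.eta N).ker) (D.kerRes C)

/-- The inclusion of `∏_N ker η_N` into `∏_N (∏_{C,N} G_i)`. -/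
def kerIncl : (∀ N : HyperNat C, (D.eta N).ker) →* (∀ N : HyperNat C, D.groupProd C N) where
  toFun k N := k N
  map_one' := rfl
  map_mul' _ _ := rfl

/-- The induced map `Θ : lim_N ∏_{C,N} G_i → lim_N Gal(Alg(∏_{C,N} K_i)/∏_C F)`,
`(g_N) ↦ (η_N g_N)`. -/
def theta : D.limGroup C →* D.limGal C where
  toFun g := ⟨fun N => D.eta N (g.1 N), fun N M h x => by
    have hg : D.res h (g.1 M) = g.1 N := g.2 h
    rw [D.eta_algIncl h, hg]⟩
  map_one' := Subtype.ext (funext fun N => map_one (D.eta N))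
  map_mul' a b := Subtype.ext (funext fun N => map_mul (D.eta N) (a.1 N) (b.1 N))

end FullyComputable

end Cohesive

end

/-! Everything rests on the fixed field of `∏_{C,N} G_i` acting on `∏_{C,N} K_i` being `∏_C F`. For
an element `a`, run an unbounded search at each index `i` for a group element of `G_{N(i)}` that
moves `a(i)`. The set of indices where the search halts is c.e., so by cohesiveness it halts almost
everywhere or almost nowhere (`AEComp.exists_search_or`). If almost everywhere, the results form an
element of `∏_{C,N} G_i` that moves `a`. If almost nowhere, almost every `a(i)` is fixed by
`G_{N(i)}`, hence lies in `F` by finite Galois theory, and `a` comes from `∏_C F`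
(`mem_range_algebraMap_of_actFun_eq`).

An algebraic extension in which some group `H` of automorphisms has the base as fixed field is
Galois, by the orbit polynomials of `H`, and `H` is dense in its Galois group, by the infinite
Galois correspondence. With `H` the image of `η_N`, this gives the Galois claim and the density of
each `η_N`.

Density of `Θ` reduces to a single level. A basic open set constrains finitely many elements at
finitely many levels, all of which embed in a common higher level `M`, where density of `η_M`
supplies some `g`. To extend `g` to a compatible family, note that the maps `f_{M,N}` are
surjective, again by a search (`res_surjective`), and that the hyper-naturals are directed and
countable, so lifting along a cofinal chain works (`exists_mem_projLim`).

The kernel statement holds because `Θ` acts coordinate by coordinate. -/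

noncomputable section

namespace Cohesive

/-! ### Galois theory of an algebraic extension with a prescribed fixed field -/

section Galois

variable {k L : Type*} [Field k] [Field L] [Algebra k L] {H : Subgroup Gal(L/k)}

/-- A neighbourhood in the Krull topology contains all the automorphisms with prescribed values on
some finite set. -/
theorem exists_finite_eqOn_of_mem_nhds {σ : Gal(L/k)} {u : Set Gal(L/k)} (hu : u ∈ 𝓝 σ) :
    ∃ s : Set L, s.Finite ∧ ∀ τ : Gal(L/k), Set.EqOn τ σ s → τ ∈ u := by
  -- Translating to the identity gives a finite subextension `E` with `σ · Gal(L/E) ⊆ u`; agreement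
  -- with `σ` on a basis of `E` is membership in this coset.
  have h1 : (fun τ => σ * τ) ⁻¹' u ∈ 𝓝 (1 : Gal(L/k)) :=
    (continuous_const_mul σ).continuousAt.preimage_mem_nhds (by rwa [mul_one])
  obtain ⟨E, hE, hEu⟩ := (krullTopology_mem_nhds_one_iff k L _).1 h1
  let b := Module.finBasis k E
  refine ⟨Set.range fun j => (b j : L), Set.finite_range _, fun τ hτ => ?_⟩
  have h2 : ∀ x : E, τ x = σ x := by
    have : (τ : L →ₗ[k] L) ∘ₗ E.val.toLinearMap = (σ : L →ₗ[k] L) ∘ₗ E.val.toLinearMap :=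
      b.ext fun j => hτ ⟨j, rfl⟩
    exact fun x => LinearMap.congr_fun this x
  have h3 : σ⁻¹ * τ ∈ E.fixingSubgroup := by
    rw [IntermediateField.mem_fixingSubgroup_iff]
    intro x hx
    rw [AlgEquiv.mul_apply, h2 ⟨x, hx⟩, ← AlgEquiv.mul_apply, inv_mul_cancel, AlgEquiv.one_apply]
  simpa using hEu h3

variable [Algebra.IsAlgebraic k L]

open Polynomial in
/-- Every element of an algebraic extension `L/k` on which a group of automorphisms has fixed field
`k` is a root of a separable polynomial over `k` that splits in `L`. -/
theorem exists_separable_splits_of_fixedField_eq_bot (hH : IntermediateField.fixedField H = ⊥)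
    (x : L) : ∃ q : k[X], aeval x q = 0 ∧ q.Separable ∧ (q.map (algebraMap k L)).Splits := by
  -- The `H`-orbit of `x` consists of roots of the minimal polynomial of `x`, so it is finite even
  -- when `H` is not.
  have hfin : {y : L | ∃ g ∈ H, g x = y}.Finite := by
    refine ((minpoly k x).rootSet_finite L).subset ?_
    rintro _ ⟨g, -, rfl⟩
    rw [mem_rootSet_of_ne (minpoly.ne_zero (Algebra.IsIntegral.isIntegral x)),
      ← AlgEquiv.coe_toAlgHom, aeval_algHom_apply, minpoly.aeval, map_zero]
  set S := hfin.toFinset with hS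
  have hmem : ∀ y, y ∈ S ↔ ∃ g ∈ H, g x = y := fun y => hfin.mem_toFinset
  -- The orbit polynomial: its roots are distinct and `H` permutes them, so its coefficients are
  -- fixed by `H` and descend to `k`.
  let q : L[X] := ∏ y ∈ S, (X - C y)
  have hinv : ∀ g ∈ H, q.map (g : L →+* L) = q := by
    intro g hg
    simp only [q, Polynomial.map_prod, Polynomial.map_sub, map_X, map_C]
    refine Finset.prod_bijective g g.bijective (fun y => ?_) fun y _ => rfl
    rw [hmem, hmem]
    constructor
    · rintro ⟨h, hh, rfl⟩
      exact ⟨g * h, H.mul_mem hg hh, rfl⟩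
    · rintro ⟨h, hh, hy⟩
      refine ⟨g⁻¹ * h, H.mul_mem (H.inv_mem hg) hh, g.injective ?_⟩
      rw [← hy, ← AlgEquiv.mul_apply, mul_inv_cancel_left]
  have hlift : q ∈ lifts (algebraMap k L) := by
    rw [lifts_iff_coeff_lifts]
    intro n
    have : q.coeff n ∈ IntermediateField.fixedField H := by
      rw [IntermediateField.mem_fixedField_iff]
      intro g hg
      conv_rhs => rw [← hinv g hg]
      rw [coeff_map]
      rfl
    rw [hH] at this
    exact IntermediateField.mem_bot.1 this
  obtain ⟨p, hp⟩ := (mem_lifts q).1 hlift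
  refine ⟨p, ?_, ?_, ?_⟩
  · rw [← eval_map_algebraMap, hp, eval_prod]
    exact Finset.prod_eq_zero ((hmem x).2 ⟨1, H.one_mem, rfl⟩) (by simp)
  · rw [← separable_map (algebraMap k L), hp]
    exact separable_prod_X_sub_C_iff'.2 fun _ _ _ _ h => h
  · rw [hp]
    exact Splits.prod fun y _ => Splits.X_sub_C y

/-- The minimal polynomial divides the orbit polynomial, from which it inherits separability and
splitting. -/
theorem isGalois_of_fixedField_eq_bot (hH : IntermediateField.fixedField H = ⊥) :
    IsGalois k L := by
  refine isGalois_iff.2 ⟨⟨fun x => ?_⟩, normal_iff.2 fun x => ⟨Algebra.IsIntegral.isIntegral x, ?_⟩⟩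
  · obtain ⟨q, h1, h2, -⟩ := exists_separable_splits_of_fixedField_eq_bot hH x
    exact h2.of_dvd (minpoly.dvd k x h1)
  · obtain ⟨q, h1, h2, h3⟩ := exists_separable_splits_of_fixedField_eq_bot hH x
    exact h3.of_dvd (Polynomial.map_ne_zero h2.ne_zero)
      (Polynomial.map_dvd _ (minpoly.dvd k x h1))

/-- Passing to the closure of `H` can only shrink the fixed field, which therefore stays `k`; a
closed subgroup is determined by its fixed field, so the closure is the whole group. -/
theorem dense_of_fixedField_eq_bot (hH : IntermediateField.fixedField H = ⊥) :
    Dense (H : Set Gal(L/k)) := by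
  have := isGalois_of_fixedField_eq_bot hH
  let T : ClosedSubgroup Gal(L/k) := ⟨H.topologicalClosure, H.isClosed_topologicalClosure⟩
  have h1 : IntermediateField.fixedField T.toSubgroup = ⊥ :=
    le_bot_iff.1 ((IntermediateField.fixedField_antitone H.le_topologicalClosure).trans hH.le)
  have h2 : H.topologicalClosure = ⊤ := by
    have := InfiniteGalois.fixingSubgroup_fixedField T
    rw [h1, IntermediateField.fixingSubgroup_bot] at this
    exact this.symm
  rw [dense_iff_closure_eq, ← Subgroup.topologicalClosure_coe, h2, Subgroup.coe_top]

/-- Stabilizers of algebraic elements are open, and the set is a finite intersection of their cosets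
by `σ`. Together with `exists_finite_eqOn_of_mem_nhds` this describes the Krull topology by values
on finite sets of elements, which are easily moved from one level to another. -/
theorem setOf_eqOn_mem_nhds (σ : Gal(L/k)) {s : Set L} (hs : s.Finite) :
    {τ : Gal(L/k) | Set.EqOn τ σ s} ∈ 𝓝 σ := by
  have h1 : ∀ x ∈ s, {τ : Gal(L/k) | τ x = σ x} ∈ 𝓝 σ := by
    intro x _
    have ho : {τ : Gal(L/k) | τ x = σ x}
        = (fun τ => σ⁻¹ * τ) ⁻¹' (MulAction.stabilizer Gal(L/k) x : Set Gal(L/k)) := by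
      ext τ
      simp only [Set.mem_ofPred_eq, Set.mem_preimage, SetLike.mem_coe, MulAction.mem_stabilizer_iff,
        mul_smul, inv_smul_eq_iff]
      rfl
    rw [ho]
    exact ((stabilizer_isOpen_of_isIntegral x).preimage (continuous_const_mul _)).mem_nhds (by simp)
  filter_upwards [(biInter_mem hs).2 h1] with τ hτ x hx
  exact Set.mem_iInter₂.1 hτ x hx

end Galois

/-! ### Projective limits over countable directed index sets -/

/-- The projections of a countable directed inverse system with surjective transition maps are
surjective. -/
theorem exists_mem_projLim {I : Type*} [LT I] [Countable I]
    (htrans : ∀ ⦃a b c : I⦄, a < b → b < c → a < c)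
    (hdir : ∀ a b : I, ∃ c, a < c ∧ b < c) (G : I → Type*) [∀ i, Group (G i)]
    (f : ∀ ⦃n m : I⦄, n < m → G m →* G n)
    (hcomp : ∀ ⦃a b c : I⦄ (h : a < b) (h' : b < c) (g : G c),
      f h (f h' g) = f (htrans h h') g)
    (hsurj : ∀ ⦃n m : I⦄ (h : n < m), Function.Surjective (f h)) (i : I) (g : G i) :
    ∃ γ ∈ projLim G f, γ i = g := by
  have : Nonempty I := ⟨i⟩
  obtain ⟨e, he⟩ := exists_surjective_nat I
  -- One step of the chain: move above both the current index and the `n`-th index of the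
  -- enumeration, and lift the current element by surjectivity.
  have hstep : ∀ (n : ℕ) (p : Σ i, G i), ∃ q : Σ i, G i, e n < q.1 ∧
      ∃ h : p.1 < q.1, f h q.2 = p.2 := by
    rintro n ⟨j, x⟩
    obtain ⟨c, h1, h2⟩ := hdir (e n) j
    obtain ⟨y, hy⟩ := hsurj h2 x
    exact ⟨⟨c, y⟩, h1, h2, hy⟩
  choose next hnext1 hnext2 using hstep
  let s : ℕ → Σ i, G i := fun n => Nat.rec ⟨i, g⟩ next n
  have hs1 : ∀ n, e n < (s (n + 1)).1 := fun n => hnext1 n (s n)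
  have hs2 : ∀ n, ∃ h : (s n).1 < (s (n + 1)).1, f h (s (n + 1)).2 = (s n).2 :=
    fun n => hnext2 n (s n)
  have hmono : ∀ j d, ∃ h : (s j).1 < (s (j + d + 1)).1, f h (s (j + d + 1)).2 = (s j).2 := by
    intro j d
    induction d with
    | zero => exact hs2 j
    | succ d ih =>
      obtain ⟨h1, h1'⟩ := ih
      obtain ⟨h2, h2'⟩ := hs2 (j + d + 1)
      exact ⟨htrans h1 h2, by rw [← hcomp h1 h2, ← h1', ← h2']; rfl⟩
  have hlt : ∀ {j l}, j < l → ∃ h : (s j).1 < (s l).1, f h (s l).2 = (s j).2 := by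
    intro j l h
    obtain ⟨d, rfl⟩ := Nat.exists_eq_add_of_lt h
    exact hmono j d
  -- The value induced at `a` does not depend on the stage of the chain from which it is projected.
  have hwd : ∀ {a : I} {j l : ℕ} (hj : a < (s j).1) (hl : a < (s l).1),
      f hj (s j).2 = f hl (s l).2 := by
    have aux : ∀ {a : I} {j l : ℕ} (hj : a < (s j).1) (hl : a < (s l).1), j < l →
        f hj (s j).2 = f hl (s l).2 := by
      intro a j l hj hl hjl
      obtain ⟨h, h'⟩ := hlt hjl
      rw [← h', hcomp]
    intro a j l hj hl
    rcases lt_trichotomy j l with h | rfl | h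
    · exact aux hj hl h
    · rfl
    · exact (aux hl hj h).symm
  have hcof : ∀ a, ∃ n, a < (s n).1 := fun a => by
    obtain ⟨n, rfl⟩ := he a
    exact ⟨n + 1, hs1 n⟩
  choose n hn using hcof
  refine ⟨fun a => f (hn a) (s (n a)).2, fun a b h => ?_, ?_⟩
  · change f h (f (hn b) _) = f (hn a) _
    rw [hcomp]
    exact hwd _ _
  -- Transition maps exist only for strict inequalities, so the value at `i` is read off from stage
  -- 1, which projects to stage 0, that is, to `g`.
  · obtain ⟨h, h'⟩ := hs2 0
    exact (hwd (l := 1) (hn i) h).trans h'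

/-! ### Searches and hyper-natural numbers -/

/-- For an unbounded search in a uniformly computable domain for an element that passes a computable
test: either the search succeeds almost everywhere, or there is almost nowhere such an element. -/
theorem AEComp.exists_search_or {C : CohesiveSet} {A : ℕ → Type*} [∀ i, Nonempty (A i)]
    (P : UCFamily A) {n u : ℕ → ℕ} (hn : AEComp C n) (hu : AEComp C u)
    {t : ℕ × ℕ × ℕ → Bool} (ht : Computable t) :
    (∃ s : ∀ i, A (n i), AEComp C (fun i => P.code (n i) (s i)) ∧
      ∀ᶠ i in C.ae, t (n i, u i, P.code (n i) (s i)) = true) ∨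
    ∀ᶠ i in C.ae, ∀ y, ¬ t (n i, u i, P.code (n i) y) = true := by
  obtain ⟨hd, hd'⟩ := P.dom
  -- The search runs over all natural numbers, so the test also has to check that the number codes
  -- an element of the domain.
  let p : ℕ × ℕ → ℕ → Bool := fun q y => (@decide _ (hd (q.1, y))) && t (q.1, q.2, y)
  have hp : Computable₂ p := by
    refine Primrec.and.to_comp.comp (hd'.comp ?_) (ht.comp ?_)
    · exact (Computable.fst.comp Computable.fst).pair Computable.snd
    · exact (Computable.fst.comp Computable.fst).pair
        ((Computable.snd.comp Computable.fst).pair Computable.snd)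
  have hpt : ∀ q y, p q y = true ↔ y ∈ Set.range (P.code q.1) ∧ t (q.1, q.2, y) = true := by
    simp [p]
  obtain ⟨φ, hφ, hφ'⟩ := hn
  obtain ⟨χ, hχ, hχ'⟩ := hu
  let r : ℕ × ℕ →. ℕ := fun q => Nat.rfind fun y => Part.some (p q y)
  have hr : Partrec r := Partrec.rfind hp.partrec₂
  let ψ : ℕ →. ℕ := fun i => (φ i).bind fun a => (χ i).bind fun b => r (a, b)
  have hψ : Partrec ψ := (Partrec.nat_iff.2 hφ).bind (Partrec.bind
    ((Partrec.nat_iff.2 hχ).comp Computable.fst)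
    (hr.comp ((Computable.snd.comp Computable.fst).pair Computable.snd)))
  have hψr : ∀ᶠ i in C.ae, ψ i = r (n i, u i) := by
    filter_upwards [hφ', hχ'] with i h1 h2
    simp only [ψ, Part.eq_some_iff.2 h1, Part.eq_some_iff.2 h2, Part.bind_some]
  -- The domain of the partial computable search is c.e., so cohesiveness decides between the two
  -- alternatives although halting at a given index is undecidable in general.
  rcases C.cohesive {i | (ψ i).Dom} hψ.dom_re with h | h
  · left
    replace h := (C.eventually_iff (fun i => (ψ i).Dom)).2 h
    have hy : ∀ᶠ i in C.ae, ∃ y : A (n i), P.code (n i) y ∈ ψ i ∧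
        t (n i, u i, P.code (n i) y) = true := by
      filter_upwards [h, hψr] with i h1 h2
      obtain ⟨y, hy⟩ := Part.dom_iff_mem.1 h1
      have h3 : p (n i, u i) y = true := by
        rw [h2] at hy
        simpa using Nat.rfind_spec hy
      obtain ⟨⟨x, rfl⟩, h4⟩ := (hpt _ _).1 h3
      exact ⟨x, hy, h4⟩
    classical
    -- The arbitrary value is used only on a negligible set of indices.
    let s : ∀ i, A (n i) := fun i =>
      if h : ∃ y : A (n i), P.code (n i) y ∈ ψ i ∧ t (n i, u i, P.code (n i) y) = true
      then h.choose else Classical.arbitrary _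
    have hs : ∀ᶠ i in C.ae, P.code (n i) (s i) ∈ ψ i ∧
        t (n i, u i, P.code (n i) (s i)) = true := by
      filter_upwards [hy] with i hi
      simp only [s, dif_pos hi]
      exact hi.choose_spec
    exact ⟨s, ⟨ψ, Partrec.nat_iff.1 hψ, hs.mono fun _ h => h.1⟩, hs.mono fun _ h => h.2⟩
  · right
    replace h := (C.eventually_iff (fun i => ¬ (ψ i).Dom)).2 h
    filter_upwards [h, hψr] with i h1 h2 y hy
    apply h1
    rw [h2]
    exact Nat.rfind_dom.2 ⟨P.code (n i) y, by
      rw [(hpt (n i, u i) _).2 ⟨⟨y, rfl⟩, hy⟩]; exact Part.mem_some _, fun _ => trivial⟩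

namespace HyperNat

variable {C : CohesiveSet}

/-- There are only countably many partial computable functions. Countability provides the cofinal
chain in `exists_mem_projLim`. -/
instance : Countable (HyperNat C) := by
  have : Countable (PartialRep C) :=
    Function.Injective.countable (β := {φ : ℕ →. ℕ // Partrec φ})
      (f := fun φ => ⟨φ.1, Partrec.nat_iff.2 φ.2.1⟩)
      fun φ ψ h => Subtype.ext (Subtype.mk.inj h)
  exact inferInstanceAs (Countable (Quotient _))

theorem lt_trans {N M P : HyperNat C} (h : N < M) (h' : M < P) : N < P := by
  rw [lt_def] at *
  filter_upwards [h, h'] with i h1 h2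
  exact h1.trans h2

theorem exists_gt_and_gt (N M : HyperNat C) : ∃ P, N < P ∧ M < P := by
  have h : AEComp C fun i => N.val i + M.val i + 1 :=
    N.aeComp.map₂ M.aeComp (f := fun p => p.1 + p.2 + 1)
      (Computable.succ.comp (Primrec.nat_add.to_comp.comp Computable.fst Computable.snd))
      (Eventually.of_forall fun _ => rfl)
  refine ⟨h.toHyperNat, ?_, ?_⟩
  all_goals
    rw [lt_def]
    filter_upwards [h.val_toHyperNat] with i hi
    omega

theorem exists_forall_gt {s : Set (HyperNat C)} (hs : s.Finite) : ∃ M, ∀ N ∈ s, N < M := by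
  induction s, hs using Set.Finite.induction_on with
  | empty => exact ⟨id C, by simp⟩
  | @insert a s _ _ ih =>
    obtain ⟨M, hM⟩ := ih
    obtain ⟨P, h1, h2⟩ := exists_gt_and_gt a M
    refine ⟨P, fun N hN => ?_⟩
    rcases hN with rfl | hN
    · exact h1
    · exact lt_trans (hM N hN) h2

end HyperNat

theorem galRes_surjective {F K : Type*} [Field F] [Field K] [Algebra F K]
    {E L : IntermediateField F K} [Normal F E] [Normal F L] (h : E ≤ L) :
    Function.Surjective (galRes h) :=
  letI : Algebra E L := (IntermediateField.inclusion h).toAlgebra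
  haveI : IsScalarTower F E L := IsScalarTower.of_algebraMap_eq fun _ => rfl
  AlgEquiv.restrictNormalHom_surjective L

namespace FullyComputable

variable {F K : Type*} [Field F] [Field K] [Algebra F K] (D : FullyComputable F K)
  {C : CohesiveSet}

/-! ### The transition maps of the groups -/

theorem stepRes_of_lt {n m : ℕ} (h : n < m) :
    D.stepRes n m = galRes (D.strictMono h).le := dif_pos h

theorem stepRes_stepRes {n m p : ℕ} (h : n < m) (h' : m < p) (g : D.L p ≃ₐ[F] D.L p) :
    D.stepRes n m (D.stepRes m p g) = D.stepRes n p g := by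
  rw [D.stepRes_of_lt h, D.stepRes_of_lt h', D.stepRes_of_lt (h.trans h')]
  apply AlgEquiv.ext
  intro x
  apply Subtype.ext
  rw [coe_galRes, coe_galRes, coe_galRes]
  rfl

theorem res_res {N M P : HyperNat C} (h : N < M) (h' : M < P) (g : D.groupProd C P) :
    D.res h (D.res h' g) = D.res (HyperNat.lt_trans h h') g :=
  CohProd.ext_sec (by
    filter_upwards [D.sec_res h (D.res h' g), D.sec_res h' g,
      D.sec_res (HyperNat.lt_trans h h') g, h, h'] with i h1 h2 h3 h4 h5
    rw [h1, h2, h3, D.stepRes_stepRes h4 h5])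

/-- A preimage of almost every entry is found by search. It need not be unique, so `AEComp.search`
does not apply; the failing alternative of `AEComp.exists_search_or` is refuted at one index by
extending automorphisms from `K_{N(i)}` to `K_{M(i)}`. -/
theorem res_surjective {N M : HyperNat C} (h : N < M) : Function.Surjective (D.res h) := by
  intro g
  obtain ⟨f, hf, hf'⟩ := D.quot
  -- The test takes one parameter besides the index `M(i)`, so `N(i)` and the code of `g(i)` are
  -- packed into one number.
  have hu : AEComp C fun i => Nat.pair (N.val i) (D.presG.code (N.val i) (g.sec i)) :=
    N.aeComp.map₂ g.aeComp (f := fun p => Nat.pair p.1 p.2)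
      (Primrec₂.natPair.to_comp.comp Computable.fst Computable.snd)
      (Eventually.of_forall fun _ => rfl)
  have ht : Computable fun q : ℕ × ℕ × ℕ =>
      decide (f (q.2.1.unpair.1, q.1, q.2.2) = q.2.1.unpair.2) := by
    have hun : Computable fun q : ℕ × ℕ × ℕ => q.2.1.unpair :=
      Primrec.unpair.to_comp.comp (Computable.fst.comp Computable.snd)
    exact (Primrec.eq (α := ℕ)).decide.to_comp.comp
      (hf.comp ((Computable.fst.comp hun).pair
        (Computable.fst.pair (Computable.snd.comp Computable.snd))))
      (Computable.snd.comp hun)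
  have key : ∀ᶠ i in C.ae, ∀ y : D.L (M.val i) ≃ₐ[F] D.L (M.val i),
      f (N.val i, M.val i, D.presG.code (M.val i) y) = D.presG.code (N.val i) (g.sec i) ↔
        D.stepRes (N.val i) (M.val i) y = g.sec i := by
    filter_upwards [h] with i hi y
    rw [hf' _ _ hi, (D.presG.inj _).eq_iff, D.stepRes_of_lt hi]
  rcases AEComp.exists_search_or D.presG.toUCFamily M.aeComp hu ht with ⟨s, hs, hs'⟩ | hno
  · refine ⟨CohProd.ofSec s hs, CohProd.ext_sec ?_⟩
    filter_upwards [D.sec_res h (CohProd.ofSec s hs),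
      CohProd.sec_ofSec (P := D.presG.toUCFamily) s hs, hs', key] with i h1 h2 h3 h4
    rw [h1, h2]
    simp only [Nat.unpair_pair, decide_eq_true_eq] at h3
    exact (h4 _).1 h3
  · obtain ⟨i, h1, h2, h3⟩ := (hno.and (key.and h)).exists
    obtain ⟨y, hy⟩ := galRes_surjective (D.strictMono h3).le (g.sec i)
    refine absurd ?_ (h1 y)
    simp only [Nat.unpair_pair, decide_eq_true_eq]
    rw [h2, D.stepRes_of_lt h3, hy]

theorem exists_mem_limGroup (N : HyperNat C) (g : D.groupProd C N) :
    ∃ γ : D.limGroup C, γ.1 N = g := by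
  obtain ⟨γ, h, h'⟩ := exists_mem_projLim (I := HyperNat C) (fun _ _ _ => HyperNat.lt_trans)
    HyperNat.exists_gt_and_gt (D.groupProd C) (fun _ _ h => D.res h)
    (fun _ _ _ => D.res_res) (fun _ _ h => D.res_surjective h) N g
  exact ⟨⟨γ, h⟩, h'⟩

/-! ### The fixed field of `∏_{C,N} G_i` -/

/-- An element of `∏_{C,N} K_i` with almost all entries in `F` comes from `∏_C F`. -/
theorem mem_range_algebraMap {N : HyperNat C} (a : D.fieldProd C N)
    (h : ∀ᶠ i in C.ae, a.sec i ∈ Set.range (algebraMap F (D.L (N.val i)))) :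
    a ∈ Set.range (algebraMap (D.baseProd C) (D.fieldProd C N)) := by
  obtain ⟨f, hf, hf'⟩ := D.embF
  obtain ⟨k, hk, hk'⟩ := D.embL
  classical
  let s : ℕ → F := fun i =>
    if h : a.sec i ∈ Set.range (algebraMap F (D.L (N.val i))) then h.choose else 0
  have hs : ∀ᶠ i in C.ae, algebraMap F (D.L (N.val i)) (s i) = a.sec i := by
    filter_upwards [h] with i hi
    simp only [s, dif_pos hi]
    exact hi.choose_spec
  -- Elements of `F` and of `K_{N(i)}` are compared by their codes in `K`, whose coding is the same
  -- at every index. By injectivity of `F → K` the preimage is unique, so `AEComp.search` finds it.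
  have hu : AEComp C fun i => D.presK.code 0 (a.sec i : K) :=
    N.aeComp.map₂ a.aeComp hk (Eventually.of_forall fun i => by
      rw [hk', D.presK_const (N.val i) 0])
  have hc : AEComp C fun i => D.presF.code ((HyperNat.id C).val i) (s i) := by
    refine AEComp.search D.presF.toUCFamily (HyperNat.id C).aeComp hu
      (t := fun q => decide (f (q.1, q.2.2) = q.2.1)) ?_ s ?_
    · exact (Primrec.eq (α := ℕ)).decide.to_comp.comp
        (hf.comp (Computable.fst.pair (Computable.snd.comp Computable.snd)))
        (Computable.fst.comp Computable.snd)
    · filter_upwards [hs] with i hi y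
      have h1 : (a.sec i : K) = algebraMap F K (s i) := by rw [← hi]; rfl
      simp only [decide_eq_true_eq, hf', D.presK_const _ 0, (D.presK.inj _).eq_iff, h1]
      exact (algebraMap F K).injective.eq_iff
  refine ⟨CohProd.ofSec s hc, CohProd.ext_sec ?_⟩
  filter_upwards [D.sec_algebraMap N (CohProd.ofSec s hc), hs,
    CohProd.sec_ofSec (P := D.presF.toUCFamily) (N := HyperNat.id C) s hc] with i h1 h2 h3
  rw [h1, h3, h2]

/-- The hypothesis speaks only of group elements with computable entries. The search for an
automorphism moving `a(i)` shows that these suffice. -/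
theorem mem_range_algebraMap_of_actFun_eq {N : HyperNat C} (a : D.fieldProd C N)
    (h : ∀ g : D.groupProd C N, D.actFun g a = a) :
    a ∈ Set.range (algebraMap (D.baseProd C) (D.fieldProd C N)) := by
  obtain ⟨f, hf, hf'⟩ := D.act
  have ht : Computable fun q : ℕ × ℕ × ℕ => !decide (f (q.1, q.2.2, q.2.1) = q.2.1) :=
    Primrec.not.to_comp.comp ((Primrec.eq (α := ℕ)).decide.to_comp.comp
      (hf.comp (Computable.fst.pair ((Computable.snd.comp Computable.snd).pair
        (Computable.fst.comp Computable.snd)))) (Computable.fst.comp Computable.snd))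
  rcases AEComp.exists_search_or D.presG.toUCFamily N.aeComp a.aeComp ht with ⟨s, hs, hs'⟩ | hno
  -- The automorphisms found form an element of `∏_{C,N} G_i` that would move almost every entry of
  -- `a`; one index gives the contradiction.
  · have h0 := D.sec_actFun (CohProd.ofSec s hs) a
    rw [h] at h0
    obtain ⟨i, h1, h2, h3⟩ := (h0.and (hs'.and
      (CohProd.sec_ofSec (P := D.presG.toUCFamily) s hs))).exists
    rw [h3] at h1
    simp [hf', ← h1] at h2
  · refine D.mem_range_algebraMap a ?_
    filter_upwards [hno] with i hi
    have := D.finite (N.val i)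
    rw [IsGalois.mem_range_algebraMap_iff_fixed]
    intro g
    simpa [hf', (D.presL.inj _).eq_iff] using hi g

theorem fixedField_range_eta (N : HyperNat C) :
    IntermediateField.fixedField (D.eta N).range = ⊥ := by
  refine le_bot_iff.1 fun x hx => ?_
  rw [IntermediateField.mem_fixedField_iff] at hx
  obtain ⟨c, hc⟩ := D.mem_range_algebraMap_of_actFun_eq x.1 fun g =>
    congrArg Subtype.val (hx (D.eta N g) ⟨g, rfl⟩)
  exact IntermediateField.mem_bot.2 ⟨c, Subtype.ext hc⟩

theorem isGalois_algPart (N : HyperNat C) : IsGalois (D.baseProd C) (D.algPart C N) :=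
  isGalois_of_fixedField_eq_bot (D.fixedField_range_eta N)

theorem denseRange_eta (N : HyperNat C) : DenseRange (D.eta N) := by
  have := dense_of_fixedField_eq_bot (D.fixedField_range_eta N)
  rwa [MonoidHom.coe_range] at this

/-! ### The induced map of the limits -/

theorem denseRange_theta : DenseRange (D.theta C) := by
  intro σ
  rw [mem_closure_iff_nhds]
  intro U hU
  rw [nhds_subtype_eq_comap, mem_comap] at hU
  obtain ⟨V, hV, hVU⟩ := hU
  rw [nhds_pi, Filter.mem_pi] at hV
  obtain ⟨I, hI, u, hu, huV⟩ := hV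
  -- Only the levels in the finite set `I` are constrained, so one level `M` lies above all of them.
  obtain ⟨M, hM⟩ := HyperNat.exists_forall_gt hI
  choose s hs hsu using fun N => exists_finite_eqOn_of_mem_nhds (hu N)
  have := hI.to_subtype
  -- All the finitely many elements whose images matter, collected at level `M`.
  let S : Set (D.algPart C M) := ⋃ N : I, D.algIncl (hM N N.2) '' s N
  have hS : S.Finite := Set.finite_iUnion fun N => (hs N).image _
  obtain ⟨_, hg, g, rfl⟩ := mem_closure_iff_nhds.1 (D.denseRange_eta M (σ.1 M)) _
    (setOf_eqOn_mem_nhds (σ.1 M) hS)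
  obtain ⟨γ, rfl⟩ := D.exists_mem_limGroup M g
  refine ⟨D.theta C γ, hVU (huV fun N hN => hsu N _ fun x hx => ?_), γ, rfl⟩
  -- Agreement at level `N` is tested after embedding in level `M`, where compatibility of both
  -- families reduces it to the choice of `g`.
  apply (D.algIncl (hM N hN)).injective
  refine ((D.theta C γ).2 (hM N hN) x).symm.trans (Eq.trans ?_ (σ.2 (hM N hN) x))
  exact hg (Set.mem_iUnion.2 ⟨⟨N, hN⟩, x, hx, rfl⟩)

/-- The comparison takes place inside `∏_N ∏_{C,N} G_i`. There, triviality under `Θ` means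
triviality under every `η_N`, and the compatibility conditions coincide because the maps between the
kernels are restrictions of the `f_{M,N}`. -/
theorem map_ker_theta :
    (D.theta C).ker.map (D.limGroup C).subtype = (D.limKer C).map (D.kerIncl C) := by
  ext g
  simp only [Subgroup.mem_map, MonoidHom.mem_ker]
  constructor
  · rintro ⟨γ, hγ, rfl⟩
    have h : ∀ N, D.eta N (γ.1 N) = 1 := fun N => congrFun (congrArg Subtype.val hγ) N
    exact ⟨fun N => ⟨γ.1 N, h N⟩, fun N M hNM => Subtype.ext (γ.2 hNM), rfl⟩
  · rintro ⟨κ, hκ, rfl⟩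
    exact ⟨⟨fun N => κ N, fun N M hNM => congrArg Subtype.val (hκ hNM)⟩,
      Subtype.ext (funext fun N => (κ N).2), rfl⟩

end FullyComputable

end Cohesive

end

theorem mainTheorem12 {F K : Type*} [Field F] [Field K] [Algebra F K]
    (hinf : ¬ FiniteDimensional F K) (D : Cohesive.FullyComputable F K)
    (C : Cohesive.CohesiveSet) :
    (∀ N : Cohesive.HyperNat C, IsGalois (D.baseProd C) (D.algPart C N)) ∧
    DenseRange (D.theta C) ∧
    (D.theta C).ker.map (D.limGroup C).subtype = (D.limKer C).map (D.kerIncl C) :=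
  ⟨D.isGalois_algPart, D.denseRange_theta, D.map_ker_theta⟩
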